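/- Let $G$ be any finite simple undirected graph (not necessarily connected) with vertex set $V$; write $N(i)$ for the set of neighbours of $i\in V$ and $d_i=|N(i)|$. Each agent $i\in V$ has an urn that initially contains exactly one ball, black or white; the initial colours are random with an arbitrary joint law (for instance, each ball white with probability $\alpha$ and black with probability $1-\alpha$). At each stage $t+1$, $t\ge 0$, every agent $i$ draws one ball uniformly at random, with replacement, from its own urn; conditionally on the history $\mathcal F_t$ (the $\sigma$-algebra generated by the initial colours and the draws of stages $1,\dots,t$) the draws of the different agents are pairwise independent. Let $X_i^{t+1}\in\{0,1\}$ be the indicator that agent $i$ draws a black ball at stage $t+1$. Then the urn of every agent $i$ receives one ball of the colour drawn for each of its neighbours, that is, the numbers $B_i^t$ of black and $W_i^t$ of white balls satisfy $$B_i^{t+1}=B_i^t+\sum_{j\in N(i)}X_j^{t+1},\qquad W_i^{t+1}=W_i^t+d_i-\sum_{j\in N(i)}X_j^{t+1}.$$ Let $Z_i^t=B_i^t/(B_i^t+W_i^t)$ be the proportion of black balls in the urn of $i$ after stage $t$, so that $\mathbb P(X_i^{t+1}=1\mid\mathcal F_t)=Z_i^t$ almost surely. Then, for every $i\in V$, the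 limit $\lim_{t\to\infty}Z_i^t$ exists almost surely. -/

import Mathlib

open MeasureTheory Filter Topology

noncomputable section

/-!
The interacting-urn model on a finite simple graph `G` with vertex set `V`.

* `init i ω` is `true` when the single ball initially in the urn of agent `i` is black,
  and `false` when it is white.
* `X t i ω`, for `t ≥ 1`, is `true` when agent `i` draws a black ball at stage `t`, and `false`
  when it draws a white one.  (The value at `t = 0` is never used.)
-/

namespace UrnModel

variable {V Ω : Type*} [Fintype V] (G : SimpleGraph V) [DecidableRel G.Adj]

/-- The number `B_i^t` of black balls in the urn of agent `i` after stage `t`: at each stage one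
black ball is added for each neighbour that draws black. -/
def blackCount (init : V → Ω → Bool) (X : ℕ → V → Ω → Bool) : ℕ → V → Ω → ℕ
  | 0, i, ω => if init i ω = true then 1 else 0
  | t + 1, i, ω => blackCount init X t i ω +
      ∑ j ∈ G.neighborFinset i, if X (t + 1) j ω = true then 1 else 0

/-- The number `W_i^t` of white balls in the urn of agent `i` after stage `t`: at each stage one
white ball is added for each neighbour that draws white. -/
def whiteCount (init : V → Ω → Bool) (X : ℕ → V → Ω → Bool) : ℕ → V → Ω → ℕ
  | 0, i, ω => if init i ω = true then 0 else 1
  | t + 1, i, ω => whiteCount init X t i ω +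
      ∑ j ∈ G.neighborFinset i, if X (t + 1) j ω = true then 0 else 1

/-- The proportion `Z_i^t = B_i^t / (B_i^t + W_i^t)` of black balls in the urn of agent `i` after
stage `t`. The denominator is `1 + d_i t`, hence never zero. -/
def blackProportion (init : V → Ω → Bool) (X : ℕ → V → Ω → Bool) (t : ℕ) (i : V) (ω : Ω) : ℝ :=
  (blackCount G init X t i ω : ℝ) /
    ((blackCount G init X t i ω : ℝ) + (whiteCount G init X t i ω : ℝ))

/-- The indicator of a black draw by agent `i` at stage `t`. -/
def drawIndicator (X : ℕ → V → Ω → Bool) (t : ℕ) (i : V) (ω : Ω) : ℝ :=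
  if X t i ω = true then 1 else 0

/-- The sigma-algebra `ℱ_t` of the history up to stage `t`, generated by the initial colours and
by the draws of stages `1, …, t`. -/
abbrev history (init : V → Ω → Bool) (X : ℕ → V → Ω → Bool) (t : ℕ) : MeasurableSpace Ω :=
  (⨆ i : V, MeasurableSpace.comap (init i) ⊤) ⊔
    ⨆ k ∈ Finset.Icc 1 t, ⨆ i : V, MeasurableSpace.comap (X k i) ⊤

/-- `(init, X)` is a realization, on the probability space `(Ω, μ)`, of the interacting-urn model
on `G`: given the history up to stage `t`, at stage `t + 1` each agent draws one ball uniformly at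
random from its current urn (so black with probability `Z_i^t`), and the draws of the agents are
pairwise (conditionally) independent. For the indicators of two events, conditional independence
is the product formula for the conditional probability that both occur. The joint law of the
initial colours is arbitrary. -/
structure IsUrnProcess [MeasurableSpace Ω] (μ : Measure Ω)
    (init : V → Ω → Bool) (X : ℕ → V → Ω → Bool) : Prop where
  measurable_init : ∀ i, Measurable (init i)
  measurable_draw : ∀ t i, Measurable (X (t + 1) i)
  condExp_draw : ∀ t i,
    μ[drawIndicator X (t + 1) i | history init X t] =ᵐ[μ] blackProportion G init X t i
  condIndep_draw : ∀ t i j, i ≠ j →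
    μ[fun ω => drawIndicator X (t + 1) i ω * drawIndicator X (t + 1) j ω | history init X t]
      =ᵐ[μ] fun ω => blackProportion G init X t i ω * blackProportion G init X t j ω

end UrnModel

end

/-!
The vector `Z t` of the proportions of black balls is a stochastic approximation of the heat flow
on the graph. One step changes `Z t i` by `g t i / (1 + d_i * (t + 1))`, where
`g t i = ∑ j ∈ N(i), (X (t + 1) j - Z t i)`, which is `-(L Z t) i`, with `L` the graph Laplacian,
plus the noise `∑ j ∈ N(i), (X (t + 1) j - Z t j)`. Up to an error of order `1 / t ^ 2` the step
size may be replaced by `1 / (c_i * (t + 1))` with `c_i = max d_i 1` (isolated vertices have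
`g t i = 0`), so that

`Z (t + 1) = Z t - (1 / (t + 1)) * C⁻¹ L (Z t) + e t`, with `C = diag c`.

The series `∑ e t` converges almost surely: the errors are summable, and for each agent `j` the sums
`∑ (X (t + 1) j - Z t j) / (t + 1)` form a martingale bounded in `L²`, as the increments are
orthogonal and the squares of the step sizes are summable
(`ae_exists_tendsto_sum_martingale_difference`).

On such a trajectory the rest is deterministic. In the coordinates `C¹ᐟ² Z` the drift is given by
the matrix `C⁻¹ᐟ² L C⁻¹ᐟ²`, which is positive semidefinite since `L` is, and in an orthonormal
eigenbasis the recursion splits into scalar ones,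
`y (t + 1) = (1 - l / (t + 1)) * y t + e t` with `l ≥ 0`. If `l = 0`, then `y` is a constant plus
the partial sums of a convergent series. If `l > 0`, then `y` plus the tail of that series is a
recursive weighted average of a null sequence, whose weights have divergent sum, and so `y` tends
to `0` (`tendsto_zero_of_weighted_average`). The drift has no oscillating modes, even on bipartite
graphs, because the step sizes tend to zero.
-/

/-! ### Perturbed linear recursions with vanishing steps -/

/-- A recursive average with vanishing weights `a n` of divergent sum forgets its starting value:
averaging a null sequence in this way produces a null sequence. -/
theorem tendsto_zero_of_weighted_average {a u ε : ℕ → ℝ} (ha0 : ∀ n, 0 ≤ a n)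
    (ha : Tendsto a atTop (𝓝 0))
    (hsum : Tendsto (fun n => ∑ k ∈ Finset.range n, a k) atTop atTop)
    (hε : Tendsto ε atTop (𝓝 0)) (hu : ∀ n, u (n + 1) = (1 - a n) * u n + a n * ε n) :
    Tendsto u atTop (𝓝 0) := by
  rw [Metric.tendsto_atTop]
  intro δ hδ
  obtain ⟨N, hN⟩ := eventually_atTop.1 <| (ha.eventually_le_const one_pos).and
    ((Metric.tendsto_nhds.1 hε) (δ / 2) (half_pos hδ))
  set S : ℕ → ℝ := fun n => ∑ k ∈ Finset.range n, a k with hS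
  -- Once `|ε n| ≤ δ / 2`, the excess of `|u n|` over `δ / 2` is damped by the factor `1 - a n`,
  -- hence by `exp (-a n)`.
  have key : ∀ n, N ≤ n → |u n| ≤ δ / 2 + |u N| * Real.exp (S N - S n) := by
    intro n hn
    induction n, hn using Nat.le_induction with
    | base => simp; positivity
    | succ n hn ih =>
      obtain ⟨h1, h2⟩ := hN n hn
      have h2 : |ε n| ≤ δ / 2 := by simpa [Real.dist_eq] using h2.le
      have h3 : |u (n + 1)| ≤ (1 - a n) * |u n| + a n * |ε n| := by
        rw [hu]
        refine (abs_add_le _ _).trans_eq ?_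
        rw [abs_mul, abs_mul, abs_of_nonneg (ha0 n), abs_of_nonneg (by linarith : 0 ≤ 1 - a n)]
      have h4 : (1 - a n) * Real.exp (S N - S n) ≤ Real.exp (S N - S (n + 1)) := by
        have : S N - S (n + 1) = -a n + (S N - S n) := by
          simp only [hS, Finset.sum_range_succ]; ring
        rw [this, Real.exp_add]
        gcongr
        exact Real.one_sub_le_exp_neg _
      have h5 := mul_le_mul_of_nonneg_left ih (by linarith : 0 ≤ 1 - a n)
      have h6 := mul_le_mul_of_nonneg_left h2 (ha0 n)
      have h7 := mul_le_mul_of_nonneg_left h4 (abs_nonneg (u N))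
      linarith
  have hexp : Tendsto (fun n => |u N| * Real.exp (S N - S n)) atTop (𝓝 0) := by
    have h : Tendsto (fun n => S N - S n) atTop atBot := by
      simpa [sub_eq_add_neg] using
        tendsto_atBot_add_const_left atTop (S N) (tendsto_neg_atTop_atBot.comp hsum)
    simpa using (Real.tendsto_exp_atBot.comp h).const_mul |u N|
  obtain ⟨M, hM⟩ := eventually_atTop.1 (hexp.eventually_lt_const (half_pos hδ))
  refine ⟨max N M, fun n hn => ?_⟩
  rw [Real.dist_eq, sub_zero]
  linarith [key n (le_of_max_le_left hn), hM n (le_of_max_le_right hn)]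

/-- The scalar recursion `y (n + 1) = (1 - a n * l) * y n + e n` with `l ≥ 0` and convergent
perturbation series converges. -/
theorem exists_tendsto_of_scalar_recursion {a y e : ℕ → ℝ} {l s : ℝ} (hl : 0 ≤ l)
    (ha0 : ∀ n, 0 ≤ a n) (ha : Tendsto a atTop (𝓝 0))
    (hsum : Tendsto (fun n => ∑ k ∈ Finset.range n, a k) atTop atTop)
    (he : Tendsto (fun n => ∑ k ∈ Finset.range n, e k) atTop (𝓝 s))
    (hy : ∀ n, y (n + 1) = y n - a n * (l * y n) + e n) :
    ∃ z, Tendsto y atTop (𝓝 z) := by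
  rcases hl.eq_or_lt with rfl | hl
  · have : ∀ n, y n = y 0 + ∑ k ∈ Finset.range n, e k := by
      intro n
      induction n with
      | zero => simp
      | succ n ih => rw [hy, ih, Finset.sum_range_succ]; ring
    exact ⟨y 0 + s, (he.const_add (y 0)).congr fun n => (this n).symm⟩
  · -- Adding to `y n` the tail of the perturbation series turns the perturbation into a null
    -- sequence multiplied by `a n * l`.
    set E : ℕ → ℝ := fun n => s - ∑ k ∈ Finset.range n, e k with hE
    have hE0 : Tendsto E atTop (𝓝 0) := by simpa using he.const_sub s
    have hu : Tendsto (fun n => y n + E n) atTop (𝓝 0) := by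
      refine tendsto_zero_of_weighted_average (a := fun n => a n * l) (ε := E)
        (fun n => mul_nonneg (ha0 n) hl.le) (by simpa using ha.mul_const l) ?_ hE0 fun n => ?_
      · simpa only [← Finset.sum_mul] using hsum.atTop_mul_const hl
      · simp only [hE, hy, Finset.sum_range_succ]; ring
    exact ⟨0, by simpa using hu.sub hE0⟩

open Matrix in
/-- In an orthonormal eigenbasis of `T` the vector recursion decouples into scalar ones. -/
theorem exists_tendsto_of_posSemidef_recursion {V : Type*} [Fintype V] {T : Matrix V V ℝ}
    (hT : T.PosSemidef) {a : ℕ → ℝ} {y e : ℕ → V → ℝ} {s : V → ℝ}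
    (ha0 : ∀ n, 0 ≤ a n) (ha : Tendsto a atTop (𝓝 0))
    (hsum : Tendsto (fun n => ∑ k ∈ Finset.range n, a k) atTop atTop)
    (he : Tendsto (fun n => ∑ k ∈ Finset.range n, e k) atTop (𝓝 s))
    (hy : ∀ n, y (n + 1) = y n - a n • (T *ᵥ y n) + e n) :
    ∃ z, Tendsto y atTop (𝓝 z) := by
  classical
  set U : Matrix V V ℝ := (hT.1.eigenvectorUnitary : Matrix V V ℝ) with hU
  have hUU : U * star U = 1 := Unitary.mul_star_self_of_mem hT.1.eigenvectorUnitary.2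
  have hUT : ∀ v k, (star U *ᵥ (T *ᵥ v)) k = hT.1.eigenvalues k * (star U *ᵥ v) k := by
    intro v k
    have h : star U * T = diagonal hT.1.eigenvalues * star U := by
      have hd : star U * T * U = diagonal hT.1.eigenvalues := by
        have := hT.1.conjStarAlgAut_star_eigenvectorUnitary
        simpa [Unitary.conjStarAlgAut_apply, Function.comp_def, hU] using this
      rw [← hd, mul_assoc, hUU, mul_one]
    rw [mulVec_mulVec, h, ← mulVec_mulVec, mulVec_diagonal]
  have hk : ∀ k, ∃ z, Tendsto (fun n => (star U *ᵥ y n) k) atTop (𝓝 z) := by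
    intro k
    have hcont : Continuous fun v : V → ℝ => (star U *ᵥ v) k :=
      (continuous_apply k).comp (Continuous.matrix_mulVec continuous_const continuous_id)
    refine exists_tendsto_of_scalar_recursion (e := fun n => (star U *ᵥ e n) k)
      (s := (star U *ᵥ s) k) (hT.eigenvalues_nonneg k) ha0 ha hsum ?_ fun n => ?_
    · simpa [Function.comp_def, mulVec_sum, Finset.sum_apply] using (hcont.tendsto s).comp he
    · simp only [hy, mulVec_add, mulVec_sub, mulVec_smul, Pi.add_apply, Pi.sub_apply,
        Pi.smul_apply, hUT, smul_eq_mul]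
  choose z hz using hk
  refine ⟨U *ᵥ z, ?_⟩
  have hcont : Continuous fun v : V → ℝ => U *ᵥ v :=
    Continuous.matrix_mulVec continuous_const continuous_id
  simpa [Function.comp_def, hUU] using (hcont.tendsto z).comp (tendsto_pi_nhds.2 hz)

open Matrix in
/-- The vector recursion driven by `C⁻¹ L`, where `L` is positive semidefinite and `C = diag c` is
positive, converges: passing to the coordinates `C¹ᐟ² x` replaces `C⁻¹ L` by the positive
semidefinite matrix `C⁻¹ᐟ² L C⁻¹ᐟ²`. -/
theorem exists_tendsto_of_weighted_posSemidef_recursion {V : Type*} [Fintype V]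
    {L : Matrix V V ℝ} (hL : L.PosSemidef) {c : V → ℝ} (hc : ∀ i, 0 < c i)
    {a : ℕ → ℝ} {x e : ℕ → V → ℝ} {s : V → ℝ}
    (ha0 : ∀ n, 0 ≤ a n) (ha : Tendsto a atTop (𝓝 0))
    (hsum : Tendsto (fun n => ∑ k ∈ Finset.range n, a k) atTop atTop)
    (he : Tendsto (fun n => ∑ k ∈ Finset.range n, e k) atTop (𝓝 s))
    (hx : ∀ n i, x (n + 1) i = x n i - a n * ((L *ᵥ x n) i / c i) + e n i) :
    ∃ z, Tendsto x atTop (𝓝 z) := by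
  classical
  set r : V → ℝ := fun i => √(c i) with hr
  have hr0 : ∀ i, r i ≠ 0 := fun i => (Real.sqrt_pos.2 (hc i)).ne'
  have hrr : ∀ i, r i * r i = c i := fun i => Real.mul_self_sqrt (hc i).le
  have hT : (diagonal r⁻¹ * L * diagonal r⁻¹).PosSemidef := by
    simpa [diagonal_conjTranspose] using hL.mul_mul_conjTranspose_same (diagonal r⁻¹)
  obtain ⟨z, hz⟩ := exists_tendsto_of_posSemidef_recursion hT (y := fun n => r * x n)
    (e := fun n => r * e n) (s := r * s) ha0 ha hsum
    (by simpa only [Finset.mul_sum] using he.const_mul r) (fun n => by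
      have hrx : diagonal r⁻¹ *ᵥ (r * x n) = x n := by
        ext i; simp [mulVec_diagonal, hr0]
      ext i
      simp only [← mulVec_mulVec, hrx, mulVec_diagonal, Pi.add_apply, Pi.sub_apply, Pi.smul_apply,
        Pi.mul_apply, Pi.inv_apply, smul_eq_mul, hx, ← hrr]
      field_simp [hr0 i])
  refine ⟨r⁻¹ * z, ?_⟩
  have h := hz.const_mul r⁻¹
  have hrx : ∀ n, r⁻¹ * (r * x n) = x n := fun n => by ext i; simp [hr0]
  simpa only [hrx] using h

/-! ### Weighted sums of bounded martingale differences -/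

/-- A function with conditional mean zero given `m` is orthogonal to the `m`-measurable ones. -/
theorem integral_mul_eq_zero_of_condExp_eq_zero {Ω : Type*} {m m₀ : MeasurableSpace Ω}
    {μ : Measure Ω} [IsFiniteMeasure μ] (hm : m ≤ m₀) {f g : Ω → ℝ} (hf : StronglyMeasurable[m] f)
    (hfg : Integrable (f * g) μ) (hg : Integrable g μ) (hg0 : μ[g | m] =ᵐ[μ] 0) :
    ∫ ω, f ω * g ω ∂μ = 0 := by
  have h : μ[f * g | m] =ᵐ[μ] 0 := by
    filter_upwards [condExp_mul_of_stronglyMeasurable_left hf hfg hg, hg0] with ω h1 h2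
    simp [h1, h2]
  calc ∫ ω, f ω * g ω ∂μ = ∫ ω, (μ[f * g | m]) ω ∂μ := (integral_condExp hm).symm
    _ = 0 := by simp [integral_congr_ae h]

/-- For bounded martingale differences `ξ` and square-summable weights `a`, the martingale
`∑ a k * ξ k` is bounded in `L²` and so converges almost surely. -/
theorem ae_exists_tendsto_sum_martingale_difference {Ω : Type*} {m₀ : MeasurableSpace Ω}
    {μ : Measure Ω} [IsProbabilityMeasure μ] (ℱ : Filtration ℕ m₀) {ξ : ℕ → Ω → ℝ} {a : ℕ → ℝ}
    (hξm : ∀ n, StronglyMeasurable[ℱ (n + 1)] (ξ n)) (hξb : ∀ n ω, |ξ n ω| ≤ 1)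
    (hξ0 : ∀ n, μ[ξ n | ℱ n] =ᵐ[μ] 0) (ha : Summable fun n => a n ^ 2) :
    ∀ᵐ ω ∂μ, ∃ s, Tendsto (fun n => ∑ k ∈ Finset.range n, a k * ξ k ω) atTop (𝓝 s) := by
  set M : ℕ → Ω → ℝ := fun n ω => ∑ k ∈ Finset.range n, a k * ξ k ω with hM
  have hMm : StronglyAdapted ℱ M := by
    intro n
    refine Finset.stronglyMeasurable_fun_sum _ fun k hk => ?_
    exact ((hξm k).mono (ℱ.mono (Finset.mem_range.1 hk))).const_mul (a k)
  have hMb : ∀ n ω, |M n ω| ≤ ∑ k ∈ Finset.range n, |a k| := by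
    intro n ω
    refine (Finset.abs_sum_le_sum_abs _ _).trans (Finset.sum_le_sum fun k _ => ?_)
    rw [abs_mul]
    exact mul_le_of_le_one_right (abs_nonneg _) (hξb k ω)
  have hξm' : ∀ n, StronglyMeasurable (ξ n) := fun n => (hξm n).mono (ℱ.le _)
  have hMm' : ∀ n, StronglyMeasurable (M n) := fun n => (hMm n).mono (ℱ.le _)
  have hint : ∀ {f : Ω → ℝ} (C : ℝ), StronglyMeasurable f → (∀ ω, |f ω| ≤ C) → Integrable f μ :=
    fun C hf hC => Integrable.of_bound hf.aestronglyMeasurable C (ae_of_all _ hC)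
  have hξi : ∀ n, Integrable (ξ n) μ := fun n => hint 1 (hξm' n) (hξb n)
  have hMi : ∀ n, Integrable (M n) μ := fun n => hint _ (hMm' n) (hMb n)
  have hMξi : ∀ n, Integrable (fun ω => M n ω * ξ n ω) μ := fun n =>
    (hξi n).bdd_mul (hMm' n).aestronglyMeasurable (ae_of_all _ (hMb n))
  have hM2i : ∀ n, Integrable (fun ω => M n ω ^ 2) μ := fun n =>
    hint _ ((hMm' n).pow 2) fun ω => by
      rw [abs_pow]; exact pow_le_pow_left₀ (abs_nonneg _) (hMb n ω) 2
  have hξ2i : ∀ n, Integrable (fun ω => ξ n ω ^ 2) μ := fun n =>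
    hint 1 ((hξm' n).pow 2) fun ω => by
      rw [abs_pow]; exact pow_le_one₀ (abs_nonneg _) (hξb n ω)
  have hsucc : ∀ n ω, M (n + 1) ω = M n ω + a n * ξ n ω := fun n ω => Finset.sum_range_succ _ _
  have hmart : Martingale M ℱ μ := by
    refine martingale_of_condExp_sub_eq_zero_nat hMm hMi fun n => ?_
    have h : M (n + 1) - M n = a n • ξ n := by ext ω; simp [hsucc]
    rw [h]
    filter_upwards [condExp_smul (μ := μ) (a n) (ξ n) (ℱ n), hξ0 n] with ω h1 h2
    simp [h1, h2]
  -- The increments are orthogonal, so their variances add up.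
  have hL2 : ∀ n, ∫ ω, M n ω ^ 2 ∂μ ≤ ∑ k ∈ Finset.range n, a k ^ 2 := by
    intro n
    induction n with
    | zero => simp [hM]
    | succ n ih =>
      have h1 : ∫ ω, ξ n ω ^ 2 ∂μ ≤ 1 := by
        calc ∫ ω, ξ n ω ^ 2 ∂μ ≤ ∫ _, (1 : ℝ) ∂μ :=
              integral_mono (hξ2i n) (integrable_const 1) fun ω => by
                simpa using pow_le_one₀ (n := 2) (abs_nonneg _) (hξb n ω)
          _ = 1 := by simp
      have h2 : ∫ ω, M n ω * ξ n ω ∂μ = 0 :=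
        integral_mul_eq_zero_of_condExp_eq_zero (ℱ.le n) (hMm n) (hMξi n) (hξi n) (hξ0 n)
      have h3 : ∫ ω, M (n + 1) ω ^ 2 ∂μ = ∫ ω, M n ω ^ 2 ∂μ
          + 2 * a n * ∫ ω, M n ω * ξ n ω ∂μ + a n ^ 2 * ∫ ω, ξ n ω ^ 2 ∂μ := by
        have h4 : Integrable (fun ω => M n ω ^ 2 + 2 * a n * (M n ω * ξ n ω)) μ :=
          (hM2i n).add ((hMξi n).const_mul _)
        rw [← integral_const_mul, ← integral_const_mul, ← integral_add (hM2i n)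
          ((hMξi n).const_mul _), ← integral_add h4 ((hξ2i n).const_mul _)]
        exact integral_congr_ae (ae_of_all _ fun ω => by simp only [hsucc]; ring)
      rw [h3, h2, Finset.sum_range_succ]
      nlinarith [mul_le_mul_of_nonneg_left h1 (sq_nonneg (a n))]
  refine hmart.submartingale.exists_ae_tendsto_of_bdd
    (R := Real.toNNReal ((1 + ∑' k, a k ^ 2) / 2)) fun n => ?_
  rw [eLpNorm_one_eq_lintegral_enorm, ← ofReal_integral_norm_eq_lintegral_enorm (hMi n)]
  refine ENNReal.ofReal_le_ofReal ?_
  calc ∫ ω, ‖M n ω‖ ∂μ ≤ ∫ ω, (1 + M n ω ^ 2) / 2 ∂μ :=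
        integral_mono (hMi n).norm (((integrable_const 1).add (hM2i n)).div_const 2) fun ω => by
          simp only [Real.norm_eq_abs]
          nlinarith [sq_nonneg (|M n ω| - 1), sq_abs (M n ω)]
    _ = (1 + ∫ ω, M n ω ^ 2 ∂μ) / 2 := by
        rw [integral_div, integral_add (integrable_const 1) (hM2i n)]; simp
    _ ≤ (1 + ∑' k, a k ^ 2) / 2 := by
        gcongr
        exact (hL2 n).trans (ha.sum_le_tsum _ fun k _ => sq_nonneg _)

/-! ### The interacting urns -/

namespace UrnModel

variable {V Ω : Type*} (init : V → Ω → Bool) (X : ℕ → V → Ω → Bool)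

theorem drawIndicator_mem_Icc (t : ℕ) (i : V) (ω : Ω) :
    drawIndicator X t i ω ∈ Set.Icc (0 : ℝ) 1 := by
  unfold drawIndicator
  split_ifs <;> simp

theorem measurable_init_history (t : ℕ) (i : V) : Measurable[history init X t] (init i) :=
  Measurable.mono (comap_measurable (init i)) ((le_iSup (fun i => MeasurableSpace.comap (init i) ⊤)
    i).trans le_sup_left) le_top

theorem measurable_draw_history {k t : ℕ} (h1 : 1 ≤ k) (h : k ≤ t) (i : V) :
    Measurable[history init X t] (X k i) :=
  Measurable.mono (comap_measurable (X k i)) (((le_iSup (fun i => MeasurableSpace.comap (X k i) ⊤)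
    i).trans (le_iSup₂_of_le k (Finset.mem_Icc.2 ⟨h1, h⟩) le_rfl)).trans le_sup_right) le_top

theorem history_mono : Monotone (history init X) := fun _ _ h =>
  sup_le_sup_left (biSup_mono fun _ hk => Finset.Icc_subset_Icc_right h hk) _

theorem measurable_drawIndicator {m : MeasurableSpace Ω} {t : ℕ} {i : V}
    (h : Measurable[m] (X t i)) : Measurable[m] (drawIndicator X t i) :=
  (Measurable.of_discrete (f := fun b : Bool => if b = true then (1 : ℝ) else 0)).comp h

variable [Fintype V] (G : SimpleGraph V) [DecidableRel G.Adj]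

theorem blackCount_add_whiteCount (t : ℕ) (i : V) (ω : Ω) :
    blackCount G init X t i ω + whiteCount G init X t i ω = 1 + G.degree i * t := by
  induction t with
  | zero => by_cases h : init i ω = true <;> simp [blackCount, whiteCount, h]
  | succ t ih =>
    have h : (∑ j ∈ G.neighborFinset i, if X (t + 1) j ω = true then 1 else 0) +
        (∑ j ∈ G.neighborFinset i, if X (t + 1) j ω = true then 0 else 1) = G.degree i := by
      rw [← Finset.sum_add_distrib, ← G.card_neighborFinset_eq_degree i,
        Finset.card_eq_sum_ones]
      exact Finset.sum_congr rfl fun j _ => by split_ifs <;> rfl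
    simp only [blackCount, whiteCount]
    linarith

theorem blackProportion_eq (t : ℕ) (i : V) (ω : Ω) :
    blackProportion G init X t i ω = blackCount G init X t i ω / (1 + G.degree i * t) := by
  unfold blackProportion
  congr 1
  exact_mod_cast blackCount_add_whiteCount init X G t i ω

theorem blackProportion_mem_Icc (t : ℕ) (i : V) (ω : Ω) :
    blackProportion G init X t i ω ∈ Set.Icc (0 : ℝ) 1 := by
  unfold blackProportion
  exact ⟨by positivity, div_le_one_of_le₀ (by simp) (by positivity)⟩

theorem blackProportion_succ (t : ℕ) (i : V) (ω : Ω) :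
    blackProportion G init X (t + 1) i ω = blackProportion G init X t i ω +
      (∑ j ∈ G.neighborFinset i, (drawIndicator X (t + 1) j ω - blackProportion G init X t i ω)) /
        (1 + G.degree i * (t + 1)) := by
  have h : (blackCount G init X (t + 1) i ω : ℝ) = blackCount G init X t i ω +
      ∑ j ∈ G.neighborFinset i, drawIndicator X (t + 1) j ω := by
    simp [blackCount, drawIndicator]
  have h1 : (1 + G.degree i * t : ℝ) ≠ 0 := by positivity
  have h2 : (1 + G.degree i * (t + 1) : ℝ) ≠ 0 := by positivity
  rw [Finset.sum_sub_distrib, Finset.sum_const, nsmul_eq_mul, G.card_neighborFinset_eq_degree,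
    blackProportion_eq, blackProportion_eq, h]
  push_cast
  field_simp
  ring

theorem measurable_blackCount_history (t : ℕ) (i : V) :
    Measurable[history init X t] (blackCount G init X t i) := by
  induction t with
  | zero =>
    exact (Measurable.of_discrete (f := fun b : Bool => if b = true then 1 else 0)).comp
      (measurable_init_history init X 0 i)
  | succ t ih =>
    refine (ih.mono (history_mono init X t.le_succ) le_rfl).add
      (Finset.measurable_fun_sum _ fun j _ => ?_)
    exact (Measurable.of_discrete (f := fun b : Bool => if b = true then 1 else 0)).comp
      (measurable_draw_history init X (by omega) le_rfl j)

theorem measurable_blackProportion_history (t : ℕ) (i : V) :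
    Measurable[history init X t] (blackProportion G init X t i) := by
  have h : blackProportion G init X t i =
      fun ω => (blackCount G init X t i ω : ℝ) / (1 + G.degree i * t) :=
    funext (blackProportion_eq init X G t i)
  rw [h]
  exact ((Measurable.of_discrete (f := fun n : ℕ => (n : ℝ))).comp
    (measurable_blackCount_history init X G t i)).div_const _

variable {G init X}

/-- Replacing the step size `1 / (1 + d * (t + 1))` of the urns by `1 / (d * (t + 1))` costs only a
summable error. An isolated vertex has `g = 0`, so that the divisor `max d 1` is harmless there. -/
theorem abs_div_sub_le_one_div_sq {d t : ℕ} {g : ℝ} (hg : |g| ≤ d) :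
    |g / (1 + d * (t + 1)) - 1 / ((t : ℝ) + 1) * (g / max (d : ℝ) 1)| ≤ 1 / ((t : ℝ) + 1) ^ 2 := by
  rcases Nat.eq_zero_or_pos d with rfl | hd
  · have : g = 0 := by simpa using hg
    simp only [this, zero_div, mul_zero, sub_zero, abs_zero]
    positivity
  · have hd1 : (1 : ℝ) ≤ d := by exact_mod_cast hd
    have hT : (0 : ℝ) < (t : ℝ) + 1 := by positivity
    set T : ℝ := (t : ℝ) + 1
    have h : g / (1 + d * T) - 1 / T * (g / max (d : ℝ) 1) = -(g / d) / ((1 + d * T) * T) := by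
      rw [max_eq_left hd1]
      field_simp
      ring
    rw [h, abs_div, abs_neg, abs_div, abs_of_pos (by positivity : 0 < (1 + d * T) * T),
      abs_of_pos (by positivity : (0 : ℝ) < d)]
    refine div_le_div₀ zero_le_one ((div_le_one (by positivity)).2 hg) (by positivity) ?_
    nlinarith

open Matrix in
/-- A trajectory along which the noise series of all agents converge is a convergent one. -/
theorem exists_tendsto_blackProportion {ω : Ω}
    (hω : ∀ i, ∃ s : ℝ, Tendsto (fun n => ∑ k ∈ Finset.range n, 1 / ((k : ℝ) + 1) *
      (drawIndicator X (k + 1) i ω - blackProportion G init X k i ω)) atTop (𝓝 s)) :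
    ∃ z : V → ℝ, Tendsto (fun t i => blackProportion G init X t i ω) atTop (𝓝 z) := by
  classical
  choose s hs using hω
  set Z : ℕ → V → ℝ := fun t i => blackProportion G init X t i ω with hZ
  set x : ℕ → V → ℝ := fun t i => drawIndicator X (t + 1) i ω with hx
  set a : ℕ → ℝ := fun t => 1 / ((t : ℝ) + 1) with ha
  set c : V → ℝ := fun i => max (G.degree i : ℝ) 1 with hc
  set g : ℕ → V → ℝ := fun t i => ∑ j ∈ G.neighborFinset i, (x t j - Z t i) with hg
  set ρ : ℕ → V → ℝ := fun t i => g t i / (1 + G.degree i * (t + 1)) - a t * (g t i / c i) with hρ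
  have hgb : ∀ t i, |g t i| ≤ G.degree i := by
    intro t i
    rw [← G.card_neighborFinset_eq_degree i, Finset.card_eq_sum_ones, Nat.cast_sum]
    refine (Finset.abs_sum_le_sum_abs _ _).trans (Finset.sum_le_sum fun j _ => ?_)
    have h1 := drawIndicator_mem_Icc X (t + 1) j ω
    have h2 := blackProportion_mem_Icc init X G t i ω
    rw [Nat.cast_one]
    exact abs_le.2 ⟨by linarith [h1.1, h2.2], by linarith [h1.2, h2.1]⟩
  have hρs : ∀ i, Summable fun t => ρ t i := fun i =>
    Summable.of_norm_bounded
      (by simpa using (summable_nat_add_iff 1).2 (Real.summable_one_div_nat_pow.2 one_lt_two))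
      fun t => abs_div_sub_le_one_div_sq (hgb t i)
  -- The drift of `Z` is minus the graph Laplacian applied to `Z`.
  have hgL : ∀ t i, g t i =
      -(G.lapMatrix ℝ *ᵥ Z t) i + ∑ j ∈ G.neighborFinset i, (x t j - Z t j) := by
    intro t i
    simp only [hg, G.lapMatrix_mulVec_apply, Finset.sum_sub_distrib, Finset.sum_const,
      nsmul_eq_mul, G.card_neighborFinset_eq_degree]
    ring
  refine exists_tendsto_of_weighted_posSemidef_recursion (G.posSemidef_lapMatrix ℝ) (c := c)
    (a := a) (e := fun t i => (∑ j ∈ G.neighborFinset i, a t * (x t j - Z t j)) / c i + ρ t i)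
    (s := fun i => (∑ j ∈ G.neighborFinset i, s j) / c i + ∑' t, ρ t i)
    (fun i => by positivity) (fun t => by positivity) tendsto_one_div_add_atTop_nhds_zero_nat
    Real.tendsto_sum_range_one_div_nat_succ_atTop (tendsto_pi_nhds.2 fun i => ?_) fun t i => ?_
  · simp only [Finset.sum_apply, Finset.sum_add_distrib, ← Finset.sum_div]
    refine Tendsto.add (Tendsto.div_const ?_ _) (hρs i).hasSum.tendsto_sum_nat
    simp_rw [Finset.sum_comm (s := Finset.range _)]
    exact tendsto_finsetSum _ fun j _ => hs j
  · have h : Z (t + 1) i = Z t i + g t i / (1 + G.degree i * (t + 1)) :=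
      blackProportion_succ init X G t i ω
    have h' : g t i / (1 + G.degree i * (t + 1)) = a t * (g t i / c i) + ρ t i := by
      simp only [hρ]; ring
    rw [h, h', hgL, ← Finset.mul_sum]
    ring

variable [mΩ : MeasurableSpace Ω] {μ : Measure Ω}

/-- The histories of an urn process as a filtration of the underlying probability space. -/
def IsUrnProcess.filtration (hX : IsUrnProcess G μ init X) : Filtration ℕ mΩ where
  seq := history init X
  mono' := history_mono init X
  le' t := sup_le (iSup_le fun i => (hX.measurable_init i).comap_le) <|
    iSup₂_le fun k hk => iSup_le fun i => by
      obtain ⟨k, rfl⟩ := Nat.exists_eq_add_of_le' (Finset.mem_Icc.1 hk).1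
      exact (hX.measurable_draw k i).comap_le

/-- The deviations of the draws from their conditional means, damped by the step size, have an
almost surely convergent sum. -/
theorem IsUrnProcess.ae_exists_tendsto_sum_noise [IsProbabilityMeasure μ]
    (hX : IsUrnProcess G μ init X) (i : V) :
    ∀ᵐ ω ∂μ, ∃ s : ℝ, Tendsto (fun n => ∑ k ∈ Finset.range n, 1 / ((k : ℝ) + 1) *
      (drawIndicator X (k + 1) i ω - blackProportion G init X k i ω)) atTop (𝓝 s) := by
  have hXm : ∀ n, Measurable[history init X (n + 1)] (drawIndicator X (n + 1) i) := fun n =>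
    measurable_drawIndicator X (measurable_draw_history init X (by omega) le_rfl i)
  have hZm := fun n => measurable_blackProportion_history init X G n i
  have hXi : ∀ n, Integrable (drawIndicator X (n + 1) i) μ := fun n =>
    Integrable.of_bound ((hXm n).mono (hX.filtration.le _) le_rfl).aestronglyMeasurable 1
      (ae_of_all _ fun ω => by
        have h := drawIndicator_mem_Icc X (n + 1) i ω
        exact abs_le.2 ⟨by linarith [h.1], h.2⟩)
  have hZi : ∀ n, Integrable (blackProportion G init X n i) μ := fun n =>
    Integrable.of_bound ((hZm n).mono (hX.filtration.le _) le_rfl).aestronglyMeasurable 1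
      (ae_of_all _ fun ω => by
        have h := blackProportion_mem_Icc init X G n i ω
        exact abs_le.2 ⟨by linarith [h.1], h.2⟩)
  refine ae_exists_tendsto_sum_martingale_difference hX.filtration
    (ξ := fun n => drawIndicator X (n + 1) i - blackProportion G init X n i)
    (a := fun k => 1 / ((k : ℝ) + 1)) (fun n => ?_) (fun n ω => ?_) (fun n => ?_) ?_
  · exact ((hXm n).sub ((hZm n).mono (history_mono init X n.le_succ) le_rfl)).stronglyMeasurable
  · have h1 := drawIndicator_mem_Icc X (n + 1) i ω
    have h2 := blackProportion_mem_Icc init X G n i ω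
    exact abs_le.2 ⟨by simp only [Pi.sub_apply]; linarith [h1.1, h2.2],
      by simp only [Pi.sub_apply]; linarith [h1.2, h2.1]⟩
  · have h1 : μ[blackProportion G init X n i | hX.filtration n] = blackProportion G init X n i :=
      condExp_of_stronglyMeasurable (hX.filtration.le n) (hZm n).stronglyMeasurable (hZi n)
    filter_upwards [condExp_sub (hXi n) (hZi n) (hX.filtration n), hX.condExp_draw n i]
      with ω h2 h3
    rw [h2, h1, Pi.sub_apply, Pi.zero_apply]
    exact sub_eq_zero.2 h3
  · simpa [div_pow] using (summable_nat_add_iff 1).2 (Real.summable_one_div_nat_pow.2 one_lt_two)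

end UrnModel

theorem theorem1 {V Ω : Type*} [Fintype V] (G : SimpleGraph V) [DecidableRel G.Adj]
    [MeasurableSpace Ω] (μ : Measure Ω) [IsProbabilityMeasure μ]
    (init : V → Ω → Bool) (X : ℕ → V → Ω → Bool)
    (hX : UrnModel.IsUrnProcess G μ init X) (i : V) :
    ∀ᵐ ω ∂μ, ∃ z : ℝ,
      Tendsto (fun t : ℕ => UrnModel.blackProportion G init X t i ω) atTop (𝓝 z) := by
  filter_upwards [ae_all_iff.2 hX.ae_exists_tendsto_sum_noise] with ω hω
  obtain ⟨z, hz⟩ := UrnModel.exists_tendsto_blackProportion hω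
  exact ⟨z i, tendsto_pi_nhds.1 hz i⟩
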